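/- For $c\in\mathbb C$ that is either $0$ or not in $[-1,1]$, let $g_k=g_k(c)$, $k\in\mathbb Z$, be the Fourier coefficients of the $2\pi$-periodic function $Q(\eta)=\frac{\sin\eta}{c+\sin\eta}=\sum_k g_k e^{ik\eta}$ (so $Q\equiv 1$ for $c=0$). For $\Lambda\in\mathbb C$ let $D(\Lambda)$ be Hill's determinant $$D(\Lambda)=\lim_{N\to\infty}\det\Big(\delta_{n,m}+\frac{\tilde g_{n-m}}{\Lambda-n^2}\Big)_{-N\le n,m\le N},\qquad \tilde g_0=0,\quad \tilde g_k=g_k\ (k\ne0),$$ where an entry with numerator zero is read as $\delta_{n,m}$ (so $D=1$ for $c=0$). For real $\theta,d$ define the Evans function $$E(c;\theta,d)=-2+2\cos(2\pi\theta)+4\,D(g_0-d^2)\,\sin^2\!\big(\pi\sqrt{g_0-d^2}\big).$$ Put $S(d)=\dfrac{\sin(2\pi\sqrt{1-d^2})}{\sqrt{1-d^2}}$ for real $d\neq\pm1$ and $S(\pm1)=2\pi$ (the limiting value); for $|d|>1$ the square root is imaginary, and its sign does not matter. (0) For every real $d$, the limit defining $D(g_0-d^2)$ exists for $c=0$ and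 for all non-real $c$ sufficiently close to $0$. (1) For all real $\theta,d$, the one-sided complex derivatives $\left.\frac{\partial E}{\partial c}\right|_{c=0}$, that is, the limits of $\frac{E(c;\theta,d)-E(0;\theta,d)}{c}$ as $c\to0$ within the open lower half plane $\{\operatorname{Im}c<0\}$ and within the open upper half plane $\{\operatorname{Im} c>0\}$, exist, the derivative $\frac{\partial E}{\partial d}(0;\theta,d)$ exists, and $$\pm i\left.\frac{\partial E}{\partial c}\right|_{c=0}=2\pi S(d),\qquad \frac{\partial E}{\partial d}(0;\theta,d)=-2d\cdot 2\pi S(d),$$ where the upper sign belongs to the lower half plane and the lower sign to the upper half plane. In particular, for $d\ne0$, $$\pm i\left.\frac{\partial E}{\partial c}\right|_{c=0}=2\pi S(d)=\frac{1}{-2d}\frac{\partial E}{\partial d}(0;\theta,d).$$ (2) Let $l\in\mathbb Z$ and let $(\theta,d)$ be a point of the circle $(\theta-l)^2+d^2=1$. Then the directional derivative at $(\theta,d)$ of the function $(\theta,d)\mapsto E(0;\theta,d)$ in the direction of the outward unit normal $(\theta-l,d)$ of the circle exists and equals $$-4\pi S(d).$$ This is a real number; it is positive for $0<|d|<\frac{\sqrt3}{2}$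 and negative for $|d|>\frac{\sqrt3}{2}$. -/

import Mathlib

open Filter Topology

noncomputable section

namespace HillEvans

/-- The complex `2π`-periodic potential `Q(η) = sin η / (c + sin η)` of Hill's equation
`g'' + Q(η) g = μ g`. -/
def potential (c : ℂ) (η : ℝ) : ℂ :=
  (Real.sin η : ℂ) / (c + (Real.sin η : ℂ))

/-- The Fourier coefficient `g_k = (1 / 2π) ∫ Q(η) e^{-ikη} dη` (over `0 ≤ η ≤ 2π`), so that
`Q(η) = ∑ g_k e^{ikη}`. -/
def coeff (c : ℂ) (k : ℤ) : ℂ :=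
  fourierCoeffOn Real.two_pi_pos (potential c) k

/-- Entry `(n, m)` of Hill's matrix: `δ_{n,m} + g̃_{n-m} / (Λ - n²)`, where `g̃_k = g_k` for `k ≠ 0`
and `g̃_0 = 0`.  When the numerator is zero the entry off the diagonal is zero. -/
def hillEntry (c Λ : ℂ) (n m : ℤ) : ℂ :=
  if n = m then 1 else coeff c (n - m) / (Λ - (n : ℂ) ^ 2)

/-- The central truncation of Hill's determinant to the indices `-N ≤ n, m ≤ N`. -/
def hillDetTrunc (c Λ : ℂ) (N : ℕ) : ℂ :=
  Matrix.det (Matrix.of fun n m : Finset.Icc (-(N : ℤ)) (N : ℤ) => hillEntry c Λ n m)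

/-- Hill's determinant `D(Λ)`: the infinite determinant, as the limit of its central truncations. -/
def hillDet (c Λ : ℂ) : ℂ :=
  limUnder atTop (hillDetTrunc c Λ)

/-- The Evans function
`E(c; θ, d) = -2 + 2 cos (2πθ) + 4 D(g_0 - d²) sin² (π √(g_0 - d²))`.
The choice of the square root does not matter, because `sin²` is even. -/
def evans (c : ℂ) (θ d : ℝ) : ℂ :=
  -2 + 2 * (Real.cos (2 * Real.pi * θ) : ℂ)
    + 4 * hillDet c (coeff c 0 - (d : ℂ) ^ 2)
      * Complex.sin (Real.pi * (coeff c 0 - (d : ℂ) ^ 2) ^ (1 / 2 : ℂ)) ^ 2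

/-- The quotient `sin (2π √(1 - d²)) / √(1 - d²)`, with its limiting value `2π` at `d = ±1`.
The square root is imaginary for `|d| > 1`; the choice of its sign does not matter. -/
def sinQuotient (d : ℝ) : ℂ :=
  if d ^ 2 = 1 then 2 * (Real.pi : ℂ)
  else
    Complex.sin (2 * Real.pi * (1 - (d : ℂ) ^ 2) ^ (1 / 2 : ℂ)) / (1 - (d : ℂ) ^ 2) ^ (1 / 2 : ℂ)

end HillEvans

end

/-! Only the mean value `g_0` contributes to first order in `c`; Hill's determinant may be replaced
by `1`.

In the half plane `s * im c < 0`, `s = ±1`, the potential is an explicit rational function of `exp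
(iη)`. Expanding it in geometric series gives all coefficients (`coeff_eq`): `g_0` continues
analytically across `c = 0` with derivative `-i s`, and every `g_k`, `k ≠ 0`, is bounded by `K =
|g_0 - 1| = O(|c|)` (`norm_coeff_le`).

`D - 1` is the sum of the nonempty principal minors of the off-diagonal matrix, whose row `n` is
bounded by `K / |Λ - n²|`. Minors of order one vanish, so `D - 1 = O(c²)` as long as `Λ = g_0 - d²`
stays away from every `n²`. At a resonance `1 - d² = n²`, `|Λ - n²|` is exactly `K`: the resonant
row has weight `1` and loses a factor `K`. One resonant row (`n = 0`, `d = ±1`) leaves `D - 1 =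
O(c)`, two (`n = ±1`, `d = 0`) leave `O(1)`. The factor `sin² (π √Λ)` vanishes there to order one
and two respectively, so `(D - 1) sin² (π √Λ) = O(c²)` always (`exists_hillDet_bound`). What remains
is the chain rule for `4 sin² (π √(g_0 - d²))`.

On the circle, `t = θ - l` is a square root of `1 - d²`, so `sin (2πθ) = t S`, and the two parts of
the normal derivative combine through `t² + d² = 1`. -/

namespace HillEvans

/-! ### Infinite determinants as sums of principal minors. -/

section PrincipalMinors

variable {ι : Type*} [DecidableEq ι]

/-- The principal minor of `M` on the index set `S`. -/
def principalMinor {R : Type*} [CommRing R] (M : Matrix ι ι R) (S : Finset ι) : R :=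
  (M.submatrix (Subtype.val : S → ι) Subtype.val).det

/-- Multilinearity in the rows: each row is taken either from `M` or from the identity. -/
theorem det_one_add_eq_sum_principalMinor {R : Type*} [CommRing R] [Fintype ι]
    (M : Matrix ι ι R) : (1 + M).det = ∑ S : Finset ι, principalMinor M S := by
  have h := (Matrix.detRowAlternating (n := ι) (R := R)).map_add_univ M.row (1 : Matrix ι ι R).row
  rw [add_comm]
  refine Eq.trans h (Finset.sum_congr rfl fun S _ => ?_)
  exact Matrix.det_piecewise_one_eq_submatrix_det M S

theorem det_one_add_submatrix_eq_sum_principalMinor {R : Type*} [CommRing R]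
    (M : Matrix ι ι R) (I : Finset ι) :
    ((1 + M).submatrix (Subtype.val : I → ι) Subtype.val).det
      = ∑ S ∈ I.powerset, principalMinor M S := by
  have h1 : (1 + M).submatrix (Subtype.val : I → ι) Subtype.val
      = 1 + M.submatrix (Subtype.val : I → ι) (Subtype.val : I → ι) := by
    ext i j
    simp only [Matrix.submatrix_apply, Matrix.add_apply, Matrix.one_apply, Subtype.ext_iff]
  rw [h1, det_one_add_eq_sum_principalMinor]
  refine Finset.sum_bij' (fun S _ => S.map (Function.Embedding.subtype _))
    (fun S _ => S.subtype (· ∈ I)) ?_ ?_ ?_ ?_ ?_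
  · intro S _
    simp only [Finset.mem_powerset]
    intro x hx
    simp only [Finset.mem_map, Function.Embedding.subtype_apply] at hx
    obtain ⟨y, _, rfl⟩ := hx
    exact y.2
  · simp
  · intro S _
    ext x
    simp
  · intro S hS
    rw [Finset.mem_powerset] at hS
    ext x
    simp only [Finset.mem_map, Finset.mem_subtype, Function.Embedding.subtype_apply]
    exact ⟨by rintro ⟨y, hy, rfl⟩; exact hy, fun hx => ⟨⟨x, hS hx⟩, hx, rfl⟩⟩
  · intro S _
    let e : S ≃ (S.map (Function.Embedding.subtype (· ∈ I))) :=
      (Equiv.ofBijective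
        (fun x => ⟨x.1.1, Finset.mem_map.2 ⟨x.1, x.2, rfl⟩⟩)
        ⟨fun x y h => Subtype.ext (Subtype.ext (Subtype.mk.inj h)), fun y => by
          obtain ⟨z, hz, hzy⟩ := Finset.mem_map.1 y.2
          exact ⟨⟨z, hz⟩, Subtype.ext hzy⟩⟩)
    simp only [principalMinor]
    rw [← Matrix.det_submatrix_equiv_self e]
    rfl

theorem principalMinor_empty {R : Type*} [CommRing R] (M : Matrix ι ι R) :
    principalMinor M ∅ = 1 :=
  Matrix.det_isEmpty

theorem principalMinor_singleton {R : Type*} [CommRing R] (M : Matrix ι ι R) (i : ι) :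
    principalMinor M {i} = M i i := by
  unfold principalMinor
  rw [Matrix.det_unique]
  have : ((default : ({i} : Finset ι)) : ι) = i := Finset.mem_singleton.1 (default : ({i} : Finset ι)).2
  simp only [Matrix.submatrix_apply, this]

theorem norm_principalMinor_le (M : Matrix ι ι ℂ) (p : ι → ℝ)
    (hM : ∀ i j, ‖M i j‖ ≤ p i) (S : Finset ι) :
    ‖principalMinor M S‖ ≤ (S.card).factorial * ∏ i ∈ S, p i := by
  unfold principalMinor
  -- After transposition each Leibniz product has one entry from every row, matching the row bounds
  -- `p`.
  rw [← Matrix.det_transpose, Matrix.det_apply]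
  refine (norm_sum_le _ _).trans ?_
  have h : ∀ σ ∈ (Finset.univ : Finset (Equiv.Perm S)),
      ‖Equiv.Perm.sign σ • ∏ i : S, (M.submatrix (Subtype.val : S → ι) Subtype.val).transpose (σ i) i‖
        ≤ ∏ i ∈ S, p i := by
    intro σ _
    have : ‖Equiv.Perm.sign σ •
        ∏ i : S, (M.submatrix (Subtype.val : S → ι) Subtype.val).transpose (σ i) i‖
        = ∏ i : S, ‖M i (σ i)‖ := by
      rcases Int.units_eq_one_or (Equiv.Perm.sign σ) with h | h <;> simp [h, norm_prod]
    rw [this, ← Finset.prod_coe_sort S p]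
    exact Finset.prod_le_prod (fun _ _ => norm_nonneg _) (fun i _ => hM i (σ i))
  refine (Finset.sum_le_card_nsmul _ _ _ h).trans (le_of_eq ?_)
  simp [Fintype.card_perm]

/-- The sum of `(|S| + j)! ∏_{i ∈ S} p i` over all subsets `S` of `U`. -/
def factorialSum (p : ι → ℝ) (j : ℕ) (U : Finset ι) : ℝ :=
  ∑ S ∈ U.powerset, ((S.card + j).factorial : ℝ) * ∏ i ∈ S, p i

theorem factorialSum_insert (p : ι → ℝ) (j : ℕ) {U : Finset ι} {a : ι} (ha : a ∉ U) :
    factorialSum p j (insert a U) = factorialSum p j U + p a * factorialSum p (j + 1) U := by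
  unfold factorialSum
  rw [Finset.sum_powerset_insert ha, Finset.mul_sum]
  congr 1
  refine Finset.sum_congr rfl fun S hS => ?_
  have haS : a ∉ S := fun h => ha (Finset.mem_powerset.1 hS h)
  rw [Finset.prod_insert haS, Finset.card_insert_of_notMem haS,
    show S.card + 1 + j = S.card + (j + 1) by ring]
  ring

theorem factorialSum_mono {κ : Type*} {p : κ → ℝ} (hp : ∀ i, 0 ≤ p i) (j : ℕ) {U V : Finset κ} (h : U ⊆ V) :
    factorialSum p j U ≤ factorialSum p j V :=
  Finset.sum_le_sum_of_subset_of_nonneg (Finset.powerset_mono.2 h) fun _ _ _ =>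
    mul_nonneg (Nat.cast_nonneg _) (Finset.prod_nonneg fun i _ => hp i)

/-- Heuristically, with `x = ∑ p i`, the sets of size `n` contribute at most `(n + j)! / n! * x ^
n`, and these terms sum to `j! / (1 - x) ^ (j + 1)`. The induction on `U` keeps `j` free because
inserting an element raises it by one. -/
theorem factorialSum_le {p : ι → ℝ} (hp : ∀ i, 0 ≤ p i) (U : Finset ι) (j : ℕ)
    (hU : ∑ i ∈ U, p i < 1) :
    factorialSum p j U ≤ j.factorial / (1 - ∑ i ∈ U, p i) ^ (j + 1) := by
  induction U using Finset.induction_on generalizing j with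
  | empty => simp [factorialSum]
  | insert a U ha ih =>
    rw [Finset.sum_insert ha] at hU ⊢
    rw [factorialSum_insert p j ha]
    have hpa := hp a
    set x := 1 - ∑ i ∈ U, p i with hx
    have hxp : 0 < x - p a := by linarith
    have hx0 : 0 < x := by linarith
    have h1 := ih j (by linarith)
    have h2 := ih (j + 1) (by linarith)
    have hy : 0 < x / (x - p a) := by positivity
    have h3 : 1 + p a / x ≤ x / (x - p a) := by
      rw [le_div_iff₀ hxp]
      have : (1 + p a / x) * (x - p a) = x - p a ^ 2 / x := by field_simp; ring
      rw [this]
      have : 0 ≤ p a ^ 2 / x := by positivity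
      linarith
    -- Bernoulli's inequality, followed by `h3`.
    have h4 : 1 + ((j + 1 : ℕ) : ℝ) * (p a / x) ≤ (x / (x - p a)) ^ (j + 1) :=
      (one_add_mul_le_pow (by have : 0 ≤ p a / x := by positivity
                              linarith) (j + 1)).trans
        (pow_le_pow_left₀ (by positivity) h3 _)
    have h5 : (j.factorial : ℝ) / x ^ (j + 1) + p a * ((j + 1).factorial / x ^ (j + 1 + 1))
        = j.factorial / x ^ (j + 1) * (1 + ((j + 1 : ℕ) : ℝ) * (p a / x)) := by
      rw [Nat.factorial_succ]
      push_cast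
      field_simp
      ring
    calc factorialSum p j U + p a * factorialSum p (j + 1) U
        ≤ (j.factorial : ℝ) / x ^ (j + 1) + p a * ((j + 1).factorial / x ^ (j + 1 + 1)) := by
          gcongr
      _ ≤ j.factorial / x ^ (j + 1) * (x / (x - p a)) ^ (j + 1) := by
          rw [h5]; gcongr
      _ = j.factorial / (1 - (p a + ∑ i ∈ U, p i)) ^ (j + 1) := by
          rw [show 1 - (p a + ∑ i ∈ U, p i) = x - p a by rw [hx]; ring, div_pow]
          field_simp

/-- The bound `|S|! ∏_{i ∈ S} p i` on principal minors, with those of order at most one left out. -/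
def minorBound (p : ι → ℝ) (S : Finset ι) : ℝ :=
  if S.card ≤ 1 then 0 else (S.card).factorial * ∏ i ∈ S, p i

theorem minorBound_nonneg {κ : Type*} {p : κ → ℝ} (hp : ∀ i, 0 ≤ p i) (S : Finset κ) :
    0 ≤ minorBound p S := by
  unfold minorBound
  split_ifs
  · exact le_rfl
  · exact mul_nonneg (Nat.cast_nonneg _) (Finset.prod_nonneg fun i _ => hp i)

theorem sum_minorBound_le {p : ι → ℝ} (hp : ∀ i, 0 ≤ p i) (U : Finset ι) :
    ∑ S ∈ U.powerset, minorBound p S ≤ factorialSum p 0 U - 1 - ∑ i ∈ U, p i := by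
  have hnn : ∀ S : Finset ι, 0 ≤ ((S.card).factorial : ℝ) * ∏ i ∈ S, p i := fun S =>
    mul_nonneg (Nat.cast_nonneg _) (Finset.prod_nonneg fun i _ => hp i)
  have h1 : factorialSum p 0 U = ∑ S ∈ U.powerset, minorBound p S
      + ∑ S ∈ U.powerset with S.card ≤ 1, ((S.card).factorial : ℝ) * ∏ i ∈ S, p i := by
    rw [Finset.sum_filter, ← Finset.sum_add_distrib]
    refine Finset.sum_congr rfl fun S _ => ?_
    unfold minorBound
    split_ifs <;> simp
  have h2 : insert ∅ (U.image fun i => ({i} : Finset ι)) ⊆ U.powerset.filter fun S => S.card ≤ 1 := by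
    intro S hS
    simp only [Finset.mem_insert, Finset.mem_image] at hS
    rcases hS with rfl | ⟨i, hi, rfl⟩ <;> simp_all
  have h3 := Finset.sum_le_sum_of_subset_of_nonneg h2 (fun S _ _ => hnn S)
  rw [Finset.sum_insert (by simp), Finset.sum_image (by intro a _ b _ h; simpa using h)] at h3
  simp only [Finset.card_empty, Nat.factorial_zero, Nat.cast_one, Finset.prod_empty, mul_one,
    Finset.card_singleton, Nat.factorial_one, Finset.prod_singleton, one_mul] at h3
  linarith

theorem factorialSum_zero_sub_le {p : ι → ℝ} (hp : ∀ i, 0 ≤ p i) {P : ℝ} (hP : P ≤ 1 / 2)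
    (U : Finset ι) (hU : ∑ i ∈ U, p i ≤ P) :
    factorialSum p 0 U - 1 - ∑ i ∈ U, p i ≤ 2 * P ^ 2 := by
  have h0 : 0 ≤ ∑ i ∈ U, p i := Finset.sum_nonneg fun i _ => hp i
  have h := factorialSum_le hp U 0 (by linarith)
  set x := ∑ i ∈ U, p i
  have h1 : (1 : ℝ) / (1 - x) ≤ 1 + x + 2 * x ^ 2 := by
    rw [div_le_iff₀ (by linarith)]
    nlinarith [mul_nonneg (sq_nonneg x) (by linarith : 0 ≤ 1 - 2 * x)]
  simp only [Nat.factorial_zero, Nat.cast_one, zero_add, pow_one] at h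
  nlinarith

/-- One resonant index `r`, whose weight is not small: the excess drops from quadratic to linear in
`P`. -/
theorem factorialSum_zero_sub_le_of_erase {p : ι → ℝ} (hp : ∀ i, 0 ≤ p i) {P : ℝ} (hP : P ≤ 1 / 2)
    (r : ι) (hr : p r ≤ 1) (U : Finset ι) (hU : ∑ i ∈ U.erase r, p i ≤ P) :
    factorialSum p 0 U - 1 - ∑ i ∈ U, p i ≤ 8 * P := by
  have h0 : 0 ≤ ∑ i ∈ U.erase r, p i := Finset.sum_nonneg fun i _ => hp i
  have h := factorialSum_zero_sub_le hp hP (U.erase r) hU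
  by_cases hrU : r ∈ U
  · have h1 := factorialSum_le hp (U.erase r) 1 (by linarith)
    have hins := factorialSum_insert p 0 (Finset.notMem_erase r U)
    have hsum := Finset.sum_insert (f := p) (Finset.notMem_erase r U)
    rw [Finset.insert_erase hrU] at hins hsum
    rw [hins, hsum]
    set x := ∑ i ∈ U.erase r, p i
    have h2 : (1 : ℝ) / (1 - x) ^ 2 ≤ 1 + 6 * x := by
      rw [div_le_iff₀ (by nlinarith)]
      nlinarith [mul_nonneg h0 (by linarith : 0 ≤ 1 - 2 * x),
        mul_nonneg (mul_nonneg h0 h0) (by linarith : 0 ≤ 1 - 2 * x)]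
    simp only [Nat.factorial_one, Nat.cast_one, zero_add] at h1 ⊢
    -- The leading term `p r * 1` cancels the `p r` in the subtracted sum, leaving `O(P)`.
    have h3 : p r * factorialSum p 1 (U.erase r) ≤ p r * (1 + 6 * x) :=
      mul_le_mul_of_nonneg_left (h1.trans h2) (hp r)
    have h4 : p r * x ≤ 1 * x := mul_le_mul_of_nonneg_right hr h0
    nlinarith
  · rw [Finset.erase_eq_of_notMem hrU] at h hU
    nlinarith [Finset.sum_nonneg fun i (_ : i ∈ U) => hp i]

/-- Two resonant indices leave only boundedness: the four choices for `r` and `s` contribute `2 + 4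
+ 4 + 16 = 26`. -/
theorem factorialSum_zero_le_of_erase_erase {p : ι → ℝ} (hp : ∀ i, 0 ≤ p i) {P : ℝ} (hP : P ≤ 1 / 2)
    {r s : ι} (hrs : r ≠ s) (hr : p r ≤ 1) (hs : p s ≤ 1) (U : Finset ι)
    (hU : ∑ i ∈ (U.erase r).erase s, p i ≤ P) :
    factorialSum p 0 U ≤ 26 := by
  set V := (U.erase r).erase s
  have h0 : 0 ≤ ∑ i ∈ V, p i := Finset.sum_nonneg fun i _ => hp i
  have hsV : s ∉ V := Finset.notMem_erase s _
  have hrV : r ∉ insert s V := by simp [V, hrs]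
  have hsub : U ⊆ insert r (insert s V) := by
    intro x hx
    by_cases h1 : x = r <;> by_cases h2 : x = s <;> simp [V, h1, h2, hx]
  refine (factorialSum_mono hp 0 hsub).trans ?_
  rw [factorialSum_insert p _ hrV, factorialSum_insert p _ hsV, factorialSum_insert p _ hsV]
  have key : ∀ j : ℕ, factorialSum p j V ≤ j.factorial * 2 ^ (j + 1) := by
    intro j
    refine (factorialSum_le hp V j (by linarith)).trans ?_
    rw [div_eq_mul_inv, ← inv_pow]
    have : (1 - ∑ i ∈ V, p i)⁻¹ ≤ 2 := by
      rw [inv_le_comm₀ (by linarith) (by norm_num)]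
      linarith
    have h' : 0 ≤ (1 - ∑ i ∈ V, p i)⁻¹ := inv_nonneg.2 (by linarith)
    gcongr
  have hnn : ∀ j : ℕ, 0 ≤ factorialSum p j V := fun j =>
    Finset.sum_nonneg fun S _ => mul_nonneg (Nat.cast_nonneg _) (Finset.prod_nonneg fun i _ => hp i)
  have k0 := key 0
  have k1 := key 1
  have k2 := key 2
  norm_num [Nat.factorial] at k0 k1 k2 ⊢
  have a1 : p s * factorialSum p 1 V ≤ 1 * 4 := mul_le_mul hs k1 (hnn 1) zero_le_one
  have a2 : p s * factorialSum p 2 V ≤ 1 * 16 := mul_le_mul hs k2 (hnn 2) zero_le_one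
  have a3 : p r * (factorialSum p 1 V + p s * factorialSum p 2 V) ≤ 1 * 20 :=
    mul_le_mul hr (by linarith)
      (add_nonneg (hnn 1) (mul_nonneg (hp s) (hnn 2))) zero_le_one
  linarith

theorem norm_principalMinor_sub_le (M : Matrix ι ι ℂ) (hdiag : ∀ i, M i i = 0) (p : ι → ℝ)
    (hM : ∀ i j, ‖M i j‖ ≤ p i) (S : Finset ι) :
    ‖principalMinor M S - if S = ∅ then 1 else 0‖ ≤ minorBound p S := by
  unfold minorBound
  split_ifs with h1 h2 h2
  · simp [h1, principalMinor_empty]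
  · exact absurd (by simp [h1]) h2
  · obtain ⟨i, rfl⟩ := Finset.card_eq_one.1
      (le_antisymm h2 (Finset.card_pos.2 (Finset.nonempty_iff_ne_empty.2 h1)))
    simp [principalMinor_singleton, hdiag]
  · simpa using norm_principalMinor_le M p hM S

/-- If the weighted sums over subsets stay bounded, the determinants of `1 + M` along any cofinal
sequence of finite index sets converge. -/
theorem exists_tendsto_det_one_add {M : Matrix ι ι ℂ} (hdiag : ∀ i, M i i = 0) {p : ι → ℝ}
    (hM : ∀ i j, ‖M i j‖ ≤ p i) {B : ℝ}
    (hB : ∀ U : Finset ι, factorialSum p 0 U - 1 - ∑ i ∈ U, p i ≤ B)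
    {I : ℕ → Finset ι} (hI : Tendsto I atTop atTop) :
    ∃ D : ℂ, Tendsto (fun N => ((1 + M).submatrix (Subtype.val : I N → ι) Subtype.val).det) atTop
      (𝓝 D) ∧ ‖D - 1‖ ≤ B := by
  have hp : ∀ i, 0 ≤ p i := fun i => (norm_nonneg _).trans (hM i i)
  have hsum : ∀ U : Finset ι, ∑ S ∈ U.powerset, minorBound p S ≤ B := fun U =>
    (sum_minorBound_le hp U).trans (hB U)
  -- A finite family of sets lies in the powerset of its union, so bounds over powersets give
  -- summability.
  have hsum' : ∀ T : Finset (Finset ι), ∑ S ∈ T, minorBound p S ≤ B := by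
    intro T
    refine le_trans (Finset.sum_le_sum_of_subset_of_nonneg ?_ fun S _ _ => minorBound_nonneg hp S)
      (hsum (T.sup id))
    exact fun S hS => Finset.mem_powerset.2 (Finset.le_sup (f := id) hS)
  have hs : Summable (minorBound p) := summable_of_sum_le (minorBound_nonneg hp) hsum'
  have hsM : Summable fun S => principalMinor M S - if S = ∅ then 1 else 0 :=
    Summable.of_norm_bounded hs (norm_principalMinor_sub_le M hdiag p hM)
  have hT : Tendsto (fun N => (I N).powerset) atTop atTop := by
    rw [tendsto_atTop]
    intro T
    filter_upwards [hI.eventually_ge_atTop (T.sup id)] with N hN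
    exact fun S hS => Finset.mem_powerset.2 ((Finset.le_sup (f := id) hS).trans hN)
  have hlim := hsM.hasSum.comp hT
  have heq : ∀ N, ∑ S ∈ (I N).powerset, (principalMinor M S - if S = ∅ then 1 else 0)
      = ((1 + M).submatrix (Subtype.val : I N → ι) Subtype.val).det - 1 := by
    intro N
    rw [det_one_add_submatrix_eq_sum_principalMinor, Finset.sum_sub_distrib]
    simp
  refine ⟨_ + 1, (hlim.add_const 1).congr fun N => ?_, ?_⟩
  · simp only [Function.comp]
    rw [heq, sub_add_cancel]
  · rw [add_sub_cancel_right]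
    exact (tsum_of_norm_bounded hs.hasSum (norm_principalMinor_sub_le M hdiag p hM)).trans
      (hs.tsum_le_of_sum_le hsum')

end PrincipalMinors

end HillEvans

namespace HillEvans

/-! ### Explicit Fourier coefficients of the potential. -/

section Coefficients

/-- The branch of the square root of `1 - c ^ 2` that is `1` at `c = 0`. -/
noncomputable def branch (c : ℂ) : ℂ := (1 - c ^ 2) ^ (1 / 2 : ℂ)

theorem cpow_half_sq (z : ℂ) : (z ^ (1 / 2 : ℂ)) ^ 2 = z := by
  rw [one_div]
  exact_mod_cast Complex.cpow_nat_inv_pow z two_ne_zero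

theorem branch_sq (c : ℂ) : branch c ^ 2 = 1 - c ^ 2 := cpow_half_sq _

theorem branch_zero : branch 0 = 1 := by simp [branch]

theorem continuousAt_branch : ContinuousAt branch 0 := by
  unfold branch
  exact ContinuousAt.cpow (by fun_prop) continuousAt_const (by simp)

theorem eventually_branch : ∀ᶠ c in 𝓝 (0 : ℂ), 0 < (branch c).re ∧ 1 / 2 < ‖branch c‖ := by
  have h1 : ContinuousAt (fun c => (branch c).re) 0 :=
    Complex.continuous_re.continuousAt.comp continuousAt_branch
  have h2 : ContinuousAt (fun c => ‖branch c‖) 0 := continuousAt_branch.norm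
  refine (h1.eventually_const_lt ?_).and (h2.eventually_const_lt ?_) <;>
    norm_num [branch_zero]

/-- The root of `z ^ 2 + 2 i c z - 1` that lies inside the unit disc when `s * im c < 0`. -/
noncomputable def innerRoot (s : ℝ) (c : ℂ) : ℂ := s * branch c - Complex.I * c

variable {s : ℝ} {c : ℂ}

theorem innerRoot_mul (hs : s ^ 2 = 1) (c : ℂ) :
    innerRoot s c * (s * branch c + Complex.I * c) = 1 := by
  have h : (s : ℂ) ^ 2 = 1 := by exact_mod_cast hs
  unfold innerRoot
  linear_combination branch c ^ 2 * h + branch_sq c - c ^ 2 * Complex.I_sq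

/-- The numbers `s b - i c` and `s b + i c`, `b = branch c`, have product `1`, so it suffices to
compare their moduli. The squares differ by `4 s im (b * conj c)`, whose sign follows from `re b >
0` and the imaginary part of `b² = 1 - c²`. -/
theorem norm_innerRoot_lt_one (hs : s ^ 2 = 1) (hc : s * c.im < 0) (hb : 0 < (branch c).re) :
    ‖innerRoot s c‖ < 1 := by
  have hprod := congrArg (fun z : ℂ => ‖z‖) (innerRoot_mul hs c)
  simp only [norm_mul, norm_one] at hprod
  have him : (branch c).re * (branch c).im = - (c.re * c.im) := by
    have := congrArg Complex.im (branch_sq c)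
    simp [pow_two] at this
    linarith
  have hre : (branch c).re ^ 2 - (branch c).im ^ 2 = 1 - c.re ^ 2 + c.im ^ 2 := by
    have := congrArg Complex.re (branch_sq c)
    simp [pow_two] at this
    linarith
  have hlt : ‖innerRoot s c‖ ^ 2 < ‖(s * branch c + Complex.I * c : ℂ)‖ ^ 2 := by
    rw [Complex.sq_norm, Complex.sq_norm]
    simp only [innerRoot, Complex.normSq_apply, Complex.sub_re, Complex.add_re, Complex.mul_re,
      Complex.ofReal_re, Complex.ofReal_im, Complex.I_re, Complex.I_im, Complex.sub_im,
      Complex.add_im, Complex.mul_im]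
    set x := (branch c).re
    set y := (branch c).im
    have h4 : x * (s * (y * c.re - x * c.im)) = - (s * c.im) * (c.re ^ 2 + x ^ 2) := by
      linear_combination s * c.re * him
    have h5 : 0 < x * (s * (y * c.re - x * c.im)) := by
      rw [h4]
      have : 0 < c.re ^ 2 + x ^ 2 := by positivity
      nlinarith
    have h6 := (pos_iff_pos_of_mul_pos h5).1 hb
    nlinarith
  have hlt' := lt_of_pow_lt_pow_left₀ 2 (norm_nonneg _) hlt
  by_contra! hge
  nlinarith

/-- The coefficients of the expansion of `w z / ((z - w) (1 + w z))` (up to the factor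
`1 / (1 + w ^ 2)`) in powers of `z`, `|z| = 1`. -/
def poleCoeff (w : ℂ) (k : ℤ) : ℂ :=
  if 0 ≤ k then (-w) ^ k.toNat else w ^ (-k).toNat

theorem poleCoeff_natCast (w : ℂ) (k : ℕ) : poleCoeff w k = (-w) ^ k := by
  simp [poleCoeff]

theorem poleCoeff_negSucc (w : ℂ) (k : ℕ) : poleCoeff w (-(k + 1 : ℤ)) = w ^ (k + 1) := by
  have : ¬ (0 : ℤ) ≤ -(k + 1 : ℤ) := by omega
  rw [poleCoeff, if_neg this]
  congr 1

theorem norm_poleCoeff (w : ℂ) (k : ℤ) : ‖poleCoeff w k‖ = ‖w‖ ^ k.natAbs := by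
  unfold poleCoeff
  split_ifs <;> rw [norm_pow] <;> try rw [norm_neg]
  all_goals congr 1; omega

theorem summable_norm_poleCoeff {w : ℂ} (hw : ‖w‖ < 1) : Summable fun k => ‖poleCoeff w k‖ := by
  simp_rw [norm_poleCoeff]
  have h := summable_geometric_of_lt_one (norm_nonneg w) hw
  refine Summable.of_nat_of_neg ?_ ?_ <;> simpa using h

theorem hasSum_poleCoeff {w z : ℂ} (hw : ‖w‖ < 1) (hz : ‖z‖ = 1) :
    HasSum (fun k : ℤ => poleCoeff w k * z ^ k) ((1 + w * z)⁻¹ + (1 - w / z)⁻¹ - 1) := by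
  have h1 : HasSum (fun k : ℕ => (-w * z) ^ k) (1 - -w * z)⁻¹ :=
    hasSum_geometric_of_norm_lt_one (by simpa [hz] using hw)
  have h2 : HasSum (fun k : ℕ => (w / z) ^ k) (1 - w / z)⁻¹ :=
    hasSum_geometric_of_norm_lt_one (by simpa [hz] using hw)
  have h3 : HasSum (fun k : ℕ => (w / z) ^ (k + 1)) ((1 - w / z)⁻¹ - 1) := by
    simpa using (hasSum_nat_add_iff' 1).2 h2
  have h4 : HasSum (fun k : ℤ => poleCoeff w k * z ^ k) ((1 - -w * z)⁻¹ + ((1 - w / z)⁻¹ - 1)) := by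
    refine HasSum.of_nat_of_neg_add_one ?_ ?_
    · refine h1.congr_fun ?_
      intro k
      rw [poleCoeff_natCast, zpow_natCast, mul_pow]
    · refine h3.congr_fun ?_
      intro k
      rw [poleCoeff_negSucc, zpow_neg, div_pow, div_eq_mul_inv]
      norm_cast
  convert h4 using 1
  ring

theorem integral_exp_int_mul (k : ℤ) :
    ∫ x in (0 : ℝ)..2 * Real.pi, Complex.exp (k * x * Complex.I) = if k = 0 then 2 * Real.pi else 0 := by
  split_ifs with h
  · simp [h]
  · have hk : (k : ℂ) * Complex.I ≠ 0 := mul_ne_zero (by exact_mod_cast h) Complex.I_ne_zero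
    have := integral_exp_mul_complex (a := 0) (b := 2 * Real.pi) hk
    simp_rw [show ∀ x : ℝ, (k : ℂ) * x * Complex.I = k * Complex.I * x from fun x => by ring]
    rw [this, Complex.ofReal_mul, Complex.ofReal_ofNat,
      show (k : ℂ) * Complex.I * (2 * Real.pi) = k * (2 * Real.pi * Complex.I) by ring,
      Complex.exp_int_mul_two_pi_mul_I]
    simp

theorem coeff_eq_integral (c : ℂ) (k : ℤ) :
    coeff c k = (1 / (2 * Real.pi)) *
      ∫ x in (0 : ℝ)..2 * Real.pi, Complex.exp (-k * x * Complex.I) * potential c x := by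
  rw [coeff, fourierCoeffOn_eq_integral]
  rw [Complex.real_smul]
  congr 1
  · push_cast; ring
  · refine intervalIntegral.integral_congr fun x _ => ?_
    simp only [smul_eq_mul]
    rw [fourier_coe_apply]
    congr 2
    push_cast
    have : (Real.pi : ℂ) ≠ 0 := by exact_mod_cast Real.pi_ne_zero
    field_simp
    ring

/-- With `z = exp (ix)` and `w` the inner root, `(z - w) (1 + w z) = 2 i w z (c + sin x)`; the rest
is partial fractions. -/
theorem potential_eq (hs : s ^ 2 = 1) (hc : s * c.im < 0) (hb : branch c ≠ 0)
    (hw : ‖innerRoot s c‖ < 1) (x : ℝ) :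
    potential c x = 1 - c * (Complex.I * s / branch c) *
      ((1 + innerRoot s c * Complex.exp (x * Complex.I))⁻¹
        + (1 - innerRoot s c / Complex.exp (x * Complex.I))⁻¹ - 1) := by
  set z := Complex.exp (x * Complex.I) with hz
  set w := innerRoot s c with hwdef
  have hz1 : ‖z‖ = 1 := Complex.norm_exp_ofReal_mul_I x
  have hz0 : z ≠ 0 := Complex.exp_ne_zero _
  have hs2 : (s : ℂ) ^ 2 = 1 := by exact_mod_cast hs
  have hne : c + (Real.sin x : ℂ) ≠ 0 := by
    intro h
    have := congrArg Complex.im h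
    simp only [Complex.add_im, Complex.ofReal_im, add_zero, Complex.zero_im] at this
    simp [this] at hc
  have hsin : (Real.sin x : ℂ) = (z⁻¹ - z) * Complex.I / 2 := by
    rw [Complex.ofReal_sin, Complex.sin, hz, ← Complex.exp_neg, neg_mul]
  have hprod := innerRoot_mul hs c
  rw [← hwdef] at hprod
  have hw2 : w ^ 2 = 1 - 2 * Complex.I * c * w := by
    have : (s * branch c + Complex.I * c : ℂ) = w + 2 * Complex.I * c := by
      rw [hwdef, innerRoot]; ring
    rw [this] at hprod
    linear_combination hprod
  have hbw : 1 + w ^ 2 = 2 * s * branch c * w := by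
    have : (s * branch c + Complex.I * c : ℂ) = 2 * s * branch c - w := by
      rw [hwdef, innerRoot]; ring
    rw [this] at hprod
    linear_combination -hprod
  have h1 : 1 + w * z ≠ 0 := by
    intro h
    have h' : w * z = -1 := by linear_combination h
    have := congrArg (fun z : ℂ => ‖z‖) h'
    simp [hz1] at this
    linarith
  have h2 : z - w ≠ 0 := by
    intro h
    have : z = w := by linear_combination h
    rw [← this, hz1] at hw
    exact lt_irrefl _ hw
  have h2' : 1 - w / z = (z - w) / z := by field_simp
  have h3 : (1 + w * z)⁻¹ + (1 - w / z)⁻¹ - 1 = (1 + w ^ 2) * z / ((z - w) * (1 + w * z)) := by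
    rw [h2', inv_div]
    field_simp
    ring
  have hw0 : w ≠ 0 := by
    intro h; rw [h] at hprod; simp at hprod
  have h4 : (z - w) * (1 + w * z) = -2 * Complex.I * w * z * (- (c + (Real.sin x : ℂ))) := by
    rw [hsin]
    field_simp
    linear_combination (-z) * hw2 + w * (z ^ 2 - 1) * Complex.I_sq
  rw [h3, h4, hbw, potential]
  field_simp
  linear_combination c * hs2

theorem coeff_eq (hs : s ^ 2 = 1) (hc : s * c.im < 0) (hb : 0 < (branch c).re) (k : ℤ) :
    coeff c k = (if k = 0 then 1 else 0)
      - c * (Complex.I * s / branch c) * poleCoeff (innerRoot s c) k := by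
  set w := innerRoot s c with hwdef
  have hw : ‖w‖ < 1 := norm_innerRoot_lt_one hs hc hb
  have hb0 : branch c ≠ 0 := by
    intro h; simp [h] at hb
  have hpi : (Real.pi : ℂ) ≠ 0 := by exact_mod_cast Real.pi_ne_zero
  set f : ℝ → ℂ := fun x => (1 + w * Complex.exp (x * Complex.I))⁻¹
        + (1 - w / Complex.exp (x * Complex.I))⁻¹ - 1 with hf
  have hsumx : ∀ x : ℝ, HasSum (fun j : ℤ => poleCoeff w j * Complex.exp ((j - k : ℤ) * x * Complex.I))
      (Complex.exp (-k * x * Complex.I) * f x) := by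
    intro x
    refine ((hasSum_poleCoeff hw (Complex.norm_exp_ofReal_mul_I x)).mul_left
      (Complex.exp (-k * x * Complex.I))).congr_fun fun j => ?_
    rw [← Complex.exp_int_mul, mul_left_comm, ← Complex.exp_add]
    congr 2
    push_cast
    ring
  have hnorm : ∀ (j : ℤ) (x : ℝ),
      ‖poleCoeff w j * Complex.exp ((j - k : ℤ) * x * Complex.I)‖ = ‖poleCoeff w j‖ := by
    intro j x
    rw [norm_mul, show (((j - k : ℤ) : ℂ) * x * Complex.I) = (((j - k : ℤ) * x : ℝ) : ℂ) * Complex.I by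
      push_cast; ring, Complex.norm_exp_ofReal_mul_I, mul_one]
  have hint := intervalIntegral.hasSum_integral_of_dominated_convergence (μ := MeasureTheory.volume)
    (a := 0) (b := 2 * Real.pi)
    (F := fun (j : ℤ) (x : ℝ) => poleCoeff w j * Complex.exp ((j - k : ℤ) * x * Complex.I))
    (f := fun x => Complex.exp (-k * x * Complex.I) * f x)
    (fun j _ => ‖poleCoeff w j‖)
    (fun j => (by fun_prop : Continuous fun x : ℝ =>
      poleCoeff w j * Complex.exp ((j - k : ℤ) * x * Complex.I)).aestronglyMeasurable)
    (fun j => Eventually.of_forall fun x _ => (hnorm j x).le)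
    (Eventually.of_forall fun x _ => summable_norm_poleCoeff hw)
    intervalIntegrable_const
    (Eventually.of_forall fun x _ => hsumx x)
  have hval : ∫ x in (0 : ℝ)..2 * Real.pi, Complex.exp (-k * x * Complex.I) * f x
      = poleCoeff w k * (2 * Real.pi) := by
    refine hint.unique ?_
    have h := hasSum_ite_eq k (poleCoeff w k * (2 * Real.pi))
    refine h.congr_fun fun j => ?_
    rw [intervalIntegral.integral_const_mul, integral_exp_int_mul]
    by_cases hj : j = k
    · simp [hj]
    · simp [hj, sub_ne_zero]
  have hfcont : Continuous f := by
    have hne1 : ∀ x : ℝ, 1 + w * Complex.exp (x * Complex.I) ≠ 0 := by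
      intro x h
      have h' : w * Complex.exp (x * Complex.I) = -1 := by linear_combination h
      have := congrArg (fun z : ℂ => ‖z‖) h'
      simp [Complex.norm_exp_ofReal_mul_I] at this
      linarith
    have hne2 : ∀ x : ℝ, 1 - w / Complex.exp (x * Complex.I) ≠ 0 := by
      intro x h
      have h' : w / Complex.exp (x * Complex.I) = 1 := by linear_combination -h
      have := congrArg (fun z : ℂ => ‖z‖) h'
      simp [Complex.norm_exp_ofReal_mul_I] at this
      linarith
    have hne3 : ∀ x : ℝ, Complex.exp (x * Complex.I) ≠ 0 := fun x => Complex.exp_ne_zero _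
    exact ((Continuous.inv₀ (by fun_prop) hne1).add
      (Continuous.inv₀ (continuous_const.sub (Continuous.div (by fun_prop) (by fun_prop) hne3))
        hne2)).sub continuous_const
  rw [coeff_eq_integral]
  have hpot : ∀ x : ℝ, Complex.exp (-k * x * Complex.I) * potential c x
      = Complex.exp ((-k : ℤ) * x * Complex.I)
        - c * (Complex.I * s / branch c) * (Complex.exp (-k * x * Complex.I) * f x) := by
    intro x
    rw [potential_eq hs hc hb0 hw x, hf]
    push_cast
    ring
  simp_rw [hpot]
  rw [intervalIntegral.integral_sub, intervalIntegral.integral_const_mul, hval,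
    integral_exp_int_mul]
  · by_cases hk : k = 0
    · simp [hk]
      field_simp
    · simp [hk]
      field_simp
  · exact (by fun_prop : Continuous fun x : ℝ => Complex.exp ((-k : ℤ) * x * Complex.I)).intervalIntegrable _ _
  · exact (continuous_const.mul ((by fun_prop : Continuous fun x : ℝ =>
      Complex.exp (-k * x * Complex.I)).mul hfcont)).intervalIntegrable _ _

theorem coeff_zero_eq (hs : s ^ 2 = 1) (hc : s * c.im < 0) (hb : 0 < (branch c).re) :
    coeff c 0 = 1 - c * (Complex.I * s / branch c) := by
  rw [coeff_eq hs hc hb]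
  simp [poleCoeff]

/-- The bound is `|g_0 - 1|` itself. Decay in `k` is discarded: it is not uniform, since the inner
root tends to `s` as `c → 0`. -/
theorem norm_coeff_le (hs : s ^ 2 = 1) (hc : s * c.im < 0) (hb : 0 < (branch c).re) {k : ℤ}
    (hk : k ≠ 0) : ‖coeff c k‖ ≤ ‖c * (Complex.I * s / branch c)‖ := by
  rw [coeff_eq hs hc hb, if_neg hk, zero_sub, norm_neg, norm_mul, norm_poleCoeff]
  exact mul_le_of_le_one_right (norm_nonneg _)
    (pow_le_one₀ (norm_nonneg _) (norm_innerRoot_lt_one hs hc hb).le)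

theorem coeff_zero_left (k : ℤ) : coeff 0 k = if k = 0 then 1 else 0 := by
  have hpi : (Real.pi : ℂ) ≠ 0 := by exact_mod_cast Real.pi_ne_zero
  have h : ∫ x in (0 : ℝ)..2 * Real.pi, Complex.exp (-k * x * Complex.I) * potential 0 x
      = ∫ x in (0 : ℝ)..2 * Real.pi, Complex.exp ((-k : ℤ) * x * Complex.I) := by
    refine intervalIntegral.integral_congr_ae ?_
    -- At the zeros of the sine the quotient `0 / 0` is `0` rather than `1`, on a null set.
    have hcount : {x : ℝ | Real.sin x = 0}.Countable := by
      have : {x : ℝ | Real.sin x = 0} ⊆ Set.range fun n : ℤ => (n : ℝ) * Real.pi := by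
        intro x hx
        obtain ⟨n, hn⟩ := Real.sin_eq_zero_iff.1 hx
        exact ⟨n, hn⟩
      exact (Set.countable_range _).mono this
    filter_upwards [hcount.ae_notMem MeasureTheory.volume] with x hx _
    have hx' : (Real.sin x : ℂ) ≠ 0 := by exact_mod_cast hx
    rw [potential, zero_add, div_self hx', mul_one]
    push_cast
    rfl
  rw [coeff_eq_integral, h, integral_exp_int_mul]
  by_cases hk : k = 0
  · simp [hk]
    field_simp
  · simp [hk]

end Coefficients

end HillEvans

namespace HillEvans

/-! ### Differentiability and zeros of `sin² (π √Λ)`. -/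

section SineFactor

/-- The factor `sin² (π √Λ)` of the Evans function. -/
noncomputable def sineFactor (Λ : ℂ) : ℂ := Complex.sin (Real.pi * Λ ^ (1 / 2 : ℂ)) ^ 2

theorem sineFactor_sq (y : ℂ) : sineFactor (y ^ 2) = Complex.sin (Real.pi * y) ^ 2 := by
  unfold sineFactor
  rcases sq_eq_sq_iff_eq_or_eq_neg.1 (cpow_half_sq (y ^ 2)) with h | h
  · rw [h]
  · rw [h, mul_neg, Complex.sin_neg, neg_sq]

theorem sinQuotient_of_sq_eq {d : ℝ} {y : ℂ} (hy : y ^ 2 = 1 - (d : ℂ) ^ 2) (hy0 : y ≠ 0) :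
    sinQuotient d = Complex.sin (2 * Real.pi * y) / y := by
  have hd : d ^ 2 ≠ 1 := by
    intro h
    have h' : (d : ℂ) ^ 2 = 1 := by exact_mod_cast h
    rw [h', sub_self] at hy
    exact hy0 (pow_eq_zero_iff two_ne_zero |>.1 hy)
  rw [sinQuotient, if_neg hd, ← hy]
  rcases sq_eq_sq_iff_eq_or_eq_neg.1 (cpow_half_sq (y ^ 2)) with h | h
  · rw [h]
  · rw [h, mul_neg, Complex.sin_neg, neg_div_neg_eq]

/-- Evenness of `sin²` allows any square root `ψ`, so on the negative axis a branch that is smooth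
there can replace the principal one. -/
theorem hasDerivAt_sineFactor_of_branch {ψ : ℂ → ℂ} (hψ : ∀ z, ψ z ^ 2 = z) {z ψ' : ℂ}
    (hz : z ≠ 0) (h : HasDerivAt ψ ψ' z) :
    HasDerivAt sineFactor (Real.pi / 2 * (Complex.sin (2 * Real.pi * ψ z) / ψ z)) z := by
  have hψ0 : ψ z ≠ 0 := fun h0 => hz (by rw [← hψ z, h0]; simp)
  have hψ' : ψ' = 1 / (2 * ψ z) := by
    have h1 := h.pow 2
    have h2 : HasDerivAt (ψ ^ 2) 1 z :=
      (hasDerivAt_id z).congr_of_eventuallyEq (Eventually.of_forall fun x => by simp [hψ x])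
    have h3 := h1.unique h2
    simp at h3
    field_simp
    linear_combination h3
  have hfun : sineFactor = fun w => Complex.sin (Real.pi * ψ w) ^ 2 :=
    funext fun w => by rw [← sineFactor_sq, hψ]
  rw [hfun]
  refine ((h.const_mul (Real.pi : ℂ)).csin.fun_pow 2).congr_deriv ?_
  rw [hψ', mul_assoc (2 : ℂ), Complex.sin_two_mul]
  field_simp
  ring

/-- No branch of the root is differentiable at `0`, but the slope is the square of `sin (π y) / y`
at `y = √z → 0`. -/
theorem hasDerivAt_sineFactor_zero : HasDerivAt sineFactor ((Real.pi : ℂ) ^ 2) 0 := by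
  have hroot : Tendsto (fun z : ℂ => z ^ (1 / 2 : ℂ)) (𝓝[≠] 0) (𝓝[≠] 0) := by
    refine tendsto_nhdsWithin_iff.2 ⟨?_, ?_⟩
    · rw [tendsto_zero_iff_norm_tendsto_zero]
      have h1 : Tendsto (fun z : ℂ => Real.sqrt ‖z‖) (𝓝[≠] 0) (𝓝 0) := by
        have : ContinuousAt (fun z : ℂ => Real.sqrt ‖z‖) 0 := by fun_prop
        simpa using this.tendsto.mono_left nhdsWithin_le_nhds
      refine h1.congr fun z => ?_
      rw [Real.sqrt_eq_iff_mul_self_eq (norm_nonneg _) (norm_nonneg _), ← norm_mul, ← pow_two,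
        cpow_half_sq]
    · filter_upwards [self_mem_nhdsWithin] with z hz h0
      refine hz ?_
      have := cpow_half_sq z
      rw [Set.mem_singleton_iff.1 h0] at this
      simpa using this.symm
  have hsin : HasDerivAt (fun y : ℂ => Complex.sin (Real.pi * y)) (Real.pi : ℂ) 0 := by
    simpa using ((hasDerivAt_id (0 : ℂ)).const_mul (Real.pi : ℂ)).csin
  rw [hasDerivAt_iff_tendsto_slope] at hsin ⊢
  refine ((hsin.comp hroot).pow 2).congr fun z => ?_
  simp only [Function.comp, slope_def_field, sineFactor, mul_zero, Complex.sin_zero, sub_zero,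
    div_pow, cpow_half_sq]
  simp

theorem hasDerivAt_sineFactor (d : ℝ) :
    HasDerivAt sineFactor (Real.pi / 2 * sinQuotient d) (1 - (d : ℂ) ^ 2) := by
  have hcast : (1 - (d : ℂ) ^ 2) = ((1 - d ^ 2 : ℝ) : ℂ) := by push_cast; rfl
  rcases lt_trichotomy (1 - d ^ 2) 0 with h | h | h
  · have hz : (1 - (d : ℂ) ^ 2) ≠ 0 := by rw [hcast]; exact_mod_cast h.ne
    have hψ : ∀ z : ℂ, (Complex.I * (-z) ^ (1 / 2 : ℂ)) ^ 2 = z := fun z => by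
      rw [mul_pow, cpow_half_sq, Complex.I_sq]; ring
    have hslit : -(1 - (d : ℂ) ^ 2) ∈ Complex.slitPlane := by
      rw [hcast, ← Complex.ofReal_neg, Complex.ofReal_mem_slitPlane]; linarith
    have hd := ((hasDerivAt_neg (1 - (d : ℂ) ^ 2)).cpow_const (c := (1 / 2 : ℂ)) hslit).const_mul Complex.I
    rw [sinQuotient_of_sq_eq (hψ _) (fun h0 => hz (by rw [← hψ (1 - (d : ℂ) ^ 2), h0]; simp))]
    exact hasDerivAt_sineFactor_of_branch hψ hz hd
  · have hd : d ^ 2 = 1 := by linarith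
    rw [hcast, h, sinQuotient, if_pos hd, Complex.ofReal_zero]
    exact hasDerivAt_sineFactor_zero.congr_deriv (by ring)
  · have hz : (1 - (d : ℂ) ^ 2) ≠ 0 := by rw [hcast]; exact_mod_cast h.ne'
    have hslit : (1 - (d : ℂ) ^ 2) ∈ Complex.slitPlane := by
      rw [hcast, Complex.ofReal_mem_slitPlane]; exact h
    have hd := (hasDerivAt_id (1 - (d : ℂ) ^ 2)).cpow_const (c := (1 / 2 : ℂ)) hslit
    rw [sinQuotient_of_sq_eq (cpow_half_sq _)
      (fun h0 => hz (by rw [← cpow_half_sq (1 - (d : ℂ) ^ 2), h0]; simp))]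
    exact hasDerivAt_sineFactor_of_branch cpow_half_sq hz hd

theorem sineFactor_zero : sineFactor 0 = 0 := by simp [sineFactor]

theorem sineFactor_isBigO_zero : sineFactor =O[𝓝 0] fun z => z := by
  simpa [sineFactor_zero] using hasDerivAt_sineFactor_zero.isBigO_sub

theorem sineFactor_isBigO_one : sineFactor =O[𝓝 1] fun z => (z - 1) ^ 2 := by
  have h : HasDerivAt (fun z : ℂ => Complex.sin (Real.pi * z ^ (1 / 2 : ℂ))) _ 1 :=
    (((hasDerivAt_id (1 : ℂ)).cpow_const (c := (1 / 2 : ℂ)) (by simp)).const_mul (Real.pi : ℂ)).csin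
  have hfun : sineFactor = fun z => Complex.sin (Real.pi * z ^ (1 / 2 : ℂ)) ^ 2 := rfl
  rw [hfun]
  simpa using h.isBigO_sub.pow 2

end SineFactor

/-! ### Distance of the spectral parameter from the squares `n²`. -/

section Resonance

/-- Since `1 - d² ≤ 1`, only `n² = 0` and `n² = 1` can come close; they give `κ₀` and `κ₁`, with a
dummy `1` at a resonance. For `n² ≥ 4` the constant `1 / 2` works. -/
theorem exists_gap (d : ℝ) : ∃ κ > 0, ∀ n : ℤ, (n : ℝ) ^ 2 ≠ 1 - d ^ 2 →
    κ * (1 + (n : ℝ) ^ 2) ≤ |1 - d ^ 2 - (n : ℝ) ^ 2| := by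
  obtain ⟨κ₀, h₀, h₀'⟩ : ∃ κ > 0, 1 - d ^ 2 ≠ 0 → κ ≤ |1 - d ^ 2| := by
    by_cases h : 1 - d ^ 2 = 0
    · exact ⟨1, one_pos, fun h' => absurd h h'⟩
    · exact ⟨_, abs_pos.2 h, fun _ => le_rfl⟩
  obtain ⟨κ₁, h₁, h₁'⟩ : ∃ κ > 0, d ≠ 0 → κ ≤ d ^ 2 / 2 := by
    by_cases h : d = 0
    · exact ⟨1, one_pos, fun h' => absurd h h'⟩
    · exact ⟨_, by positivity, fun _ => le_rfl⟩
  refine ⟨min (min κ₀ κ₁) (1 / 2), by positivity, fun n hn => ?_⟩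
  have hκ₀ : min (min κ₀ κ₁) (1 / 2) ≤ κ₀ := (min_le_left _ _).trans (min_le_left _ _)
  have hκ₁ : min (min κ₀ κ₁) (1 / 2) ≤ κ₁ := (min_le_left _ _).trans (min_le_right _ _)
  have hκ₂ : min (min κ₀ κ₁) (1 / 2) ≤ 1 / 2 := min_le_right _ _
  set κ := min (min κ₀ κ₁) (1 / 2)
  have hcases : n ^ 2 = 0 ∨ n ^ 2 = 1 ∨ 4 ≤ n ^ 2 := by
    rcases le_or_gt 2 |n| with h | h
    · right; right
      rw [← sq_abs]; nlinarith
    · have : |n| = 0 ∨ |n| = 1 := by have := abs_nonneg n; omega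
      rcases this with h | h <;> rw [← sq_abs, h] <;> simp
  rcases hcases with h | h | h
  · have h' : (n : ℝ) ^ 2 = 0 := by exact_mod_cast h
    rw [h'] at hn ⊢
    simpa using hκ₀.trans (h₀' hn.symm)
  · have h' : (n : ℝ) ^ 2 = 1 := by exact_mod_cast h
    rw [h'] at hn ⊢
    have hd : d ≠ 0 := by rintro rfl; simp at hn
    have := hκ₁.trans (h₁' hd)
    rw [show 1 - d ^ 2 - 1 = -d ^ 2 by ring, neg_eq_neg_one_mul, abs_mul]
    norm_num
    linarith
  · have h' : (4 : ℝ) ≤ (n : ℝ) ^ 2 := by exact_mod_cast h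
    rw [abs_sub_comm]
    refine le_trans ?_ (le_abs_self _)
    nlinarith [sq_nonneg d]

theorem summable_one_div_one_add_sq : Summable fun n : ℤ => 1 / (1 + (n : ℝ) ^ 2) := by
  have h : Summable fun n : ℤ => 1 / (n : ℝ) ^ 2 := Real.summable_one_div_int_pow.2 one_lt_two
  refine Summable.of_norm_bounded_eventually h ?_
  have : ({0}ᶜ : Set ℤ) ∈ cofinite := (Set.finite_singleton (0 : ℤ)).compl_mem_cofinite
  filter_upwards [this] with n hn
  have hn0 : (0 : ℝ) < (n : ℝ) ^ 2 := by
    have : (n : ℝ) ≠ 0 := by exact_mod_cast hn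
    positivity
  rw [Real.norm_of_nonneg (by positivity)]
  exact one_div_le_one_div_of_le hn0 (by linarith)

theorem exists_sum_div_norm_le (d : ℝ) : ∃ C > 0, ∃ δ > 0, ∀ Λ : ℂ, ∀ K : ℝ,
    ‖Λ - (1 - (d : ℂ) ^ 2)‖ = K → K ≤ δ → ∀ U : Finset ℤ, (∀ n ∈ U, (n : ℝ) ^ 2 ≠ 1 - d ^ 2) →
      ∑ n ∈ U, K / ‖Λ - (n : ℂ) ^ 2‖ ≤ C * K := by
  obtain ⟨κ, hκ, hgap⟩ := exists_gap d
  have hT : 0 ≤ ∑' n : ℤ, 1 / (1 + (n : ℝ) ^ 2) := tsum_nonneg fun n => by positivity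
  refine ⟨2 / κ * (1 + ∑' n : ℤ, 1 / (1 + (n : ℝ) ^ 2)), by positivity, κ / 2, by positivity, ?_⟩
  intro Λ K hΛ hK U hU
  have hK0 : 0 ≤ K := hΛ ▸ norm_nonneg _
  have hterm : ∀ n ∈ U, K / ‖Λ - (n : ℂ) ^ 2‖ ≤ 2 / κ * K * (1 / (1 + (n : ℝ) ^ 2)) := by
    intro n hn
    have h1 := hgap n (hU n hn)
    have h2 : |1 - d ^ 2 - (n : ℝ) ^ 2| = ‖(1 - (d : ℂ) ^ 2) - (n : ℂ) ^ 2‖ := by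
      rw [← Real.norm_eq_abs, ← Complex.norm_real]
      push_cast
      rfl
    have h3 : ‖(1 - (d : ℂ) ^ 2) - (n : ℂ) ^ 2‖ ≤ ‖Λ - (n : ℂ) ^ 2‖ + K := by
      rw [← hΛ]
      have := norm_sub_le (Λ - (n : ℂ) ^ 2) (Λ - (1 - (d : ℂ) ^ 2))
      rwa [show Λ - (n : ℂ) ^ 2 - (Λ - (1 - (d : ℂ) ^ 2)) = (1 - (d : ℂ) ^ 2) - (n : ℂ) ^ 2 by ring]
        at this
    have h4 : κ / 2 * (1 + (n : ℝ) ^ 2) ≤ ‖Λ - (n : ℂ) ^ 2‖ := by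
      have : 0 ≤ κ / 2 * (n : ℝ) ^ 2 := by positivity
      rw [h2] at h1
      nlinarith
    calc K / ‖Λ - (n : ℂ) ^ 2‖ ≤ K / (κ / 2 * (1 + (n : ℝ) ^ 2)) := by gcongr
      _ = 2 / κ * K * (1 / (1 + (n : ℝ) ^ 2)) := by field_simp
  refine (Finset.sum_le_sum hterm).trans ?_
  rw [← Finset.mul_sum]
  have := summable_one_div_one_add_sq.sum_le_tsum U (fun n _ => by positivity)
  calc 2 / κ * K * ∑ n ∈ U, 1 / (1 + (n : ℝ) ^ 2)
      ≤ 2 / κ * K * (1 + ∑' n : ℤ, 1 / (1 + (n : ℝ) ^ 2)) := by gcongr; linarith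
    _ = _ := by ring

end Resonance

end HillEvans

namespace HillEvans

/-! ### Hill's determinant near `c = 0` and the derivative in `c`. -/

section Determinant

/-- Hill's matrix without its diagonal. -/
noncomputable def hillOffDiag (c Λ : ℂ) : Matrix ℤ ℤ ℂ :=
  Matrix.of fun n m => if n = m then 0 else coeff c (n - m) / (Λ - (n : ℂ) ^ 2)

theorem hillDetTrunc_eq (c Λ : ℂ) (N : ℕ) :
    hillDetTrunc c Λ N = ((1 + hillOffDiag c Λ).submatrix
      (Subtype.val : Finset.Icc (-(N : ℤ)) (N : ℤ) → ℤ) Subtype.val).det := by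
  unfold hillDetTrunc
  congr 1
  ext n m
  simp only [Matrix.of_apply, Matrix.submatrix_apply, Matrix.add_apply, Matrix.one_apply,
    hillOffDiag, hillEntry]
  split_ifs <;> simp

theorem tendsto_Icc_neg_atTop :
    Tendsto (fun N : ℕ => Finset.Icc (-(N : ℤ)) (N : ℤ)) atTop atTop := by
  refine tendsto_atTop_finset_of_monotone
    (fun a b h => Finset.Icc_subset_Icc (by omega) (by omega)) fun x => ⟨x.natAbs, ?_⟩
  rw [Finset.mem_Icc]
  omega

theorem tendsto_hillDetTrunc_of_bound {c Λ : ℂ} {K : ℝ} (hK : 0 ≤ K)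
    (hcoeff : ∀ k : ℤ, k ≠ 0 → ‖coeff c k‖ ≤ K) {B : ℝ}
    (hB : ∀ U : Finset ℤ, factorialSum (fun n : ℤ => K / ‖Λ - (n : ℂ) ^ 2‖) 0 U - 1
      - ∑ n ∈ U, K / ‖Λ - (n : ℂ) ^ 2‖ ≤ B) :
    Tendsto (hillDetTrunc c Λ) atTop (𝓝 (hillDet c Λ)) ∧ ‖hillDet c Λ - 1‖ ≤ B := by
  have hM : ∀ n m, ‖hillOffDiag c Λ n m‖ ≤ K / ‖Λ - (n : ℂ) ^ 2‖ := by
    intro n m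
    simp only [hillOffDiag, Matrix.of_apply]
    split_ifs with h
    · rw [norm_zero]; positivity
    · rw [norm_div]
      exact div_le_div_of_nonneg_right (hcoeff _ (sub_ne_zero.2 h)) (norm_nonneg _)
  obtain ⟨D, hD, hDB⟩ := exists_tendsto_det_one_add (M := hillOffDiag c Λ)
    (fun n => by simp [hillOffDiag]) hM hB tendsto_Icc_neg_atTop
  have hD' : Tendsto (hillDetTrunc c Λ) atTop (𝓝 D) :=
    hD.congr fun N => (hillDetTrunc_eq c Λ N).symm
  have : hillDet c Λ = D := hD'.limUnder_eq
  rw [this]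
  exact ⟨hD', hDB⟩

theorem hillDetTrunc_zero_left (Λ : ℂ) (N : ℕ) : hillDetTrunc 0 Λ N = 1 := by
  have h : hillOffDiag 0 Λ = 0 := by
    ext n m
    simp only [hillOffDiag, Matrix.of_apply, Matrix.zero_apply]
    split_ifs with h
    · rfl
    · rw [coeff_zero_left, if_neg (sub_ne_zero.2 h), zero_div]
  rw [hillDetTrunc_eq, h, add_zero, Matrix.submatrix_one _ Subtype.val_injective, Matrix.det_one]

theorem tendsto_hillDetTrunc_zero_left (Λ : ℂ) :
    Tendsto (hillDetTrunc 0 Λ) atTop (𝓝 1) :=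
  tendsto_const_nhds.congr fun N => (hillDetTrunc_zero_left Λ N).symm

theorem hillDet_zero_left (Λ : ℂ) : hillDet 0 Λ = 1 :=
  (tendsto_hillDetTrunc_zero_left Λ).limUnder_eq

theorem evans_zero_left (θ d : ℝ) : evans 0 θ d =
    -2 + 2 * (Real.cos (2 * Real.pi * θ) : ℂ) + 4 * sineFactor (1 - (d : ℂ) ^ 2) := by
  rw [evans, hillDet_zero_left, coeff_zero_left, if_pos rfl, sineFactor, mul_one]

/-- The mean value `g_0(c)` for `s * im c < 0`, extended analytically across `c = 0`. -/
noncomputable def meanValue (s : ℝ) (c : ℂ) : ℂ := 1 - c * (Complex.I * s / branch c)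

variable {s : ℝ}

theorem hasDerivAt_meanValue (s : ℝ) : HasDerivAt (meanValue s) (-(Complex.I * s)) 0 := by
  have hb : HasDerivAt branch _ 0 :=
    (((hasDerivAt_id (0 : ℂ)).pow 2).const_sub 1).cpow_const (c := (1 / 2 : ℂ)) (by simp)
  have h1 := (hasDerivAt_const (0 : ℂ) (Complex.I * (s : ℂ))).div hb (by simp [branch_zero])
  refine (((hasDerivAt_id (0 : ℂ)).mul h1).const_sub 1).congr_deriv ?_
  simp [branch_zero]

theorem norm_meanValue_sub_one_le (hs : s ^ 2 = 1) {c : ℂ} (hb : 1 / 2 < ‖branch c‖) :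
    ‖c * (Complex.I * s / branch c)‖ ≤ 2 * ‖c‖ := by
  have hs' : ‖(s : ℂ)‖ = 1 := by
    rw [Complex.norm_real, Real.norm_eq_abs]
    exact (pow_eq_one_iff_of_nonneg (abs_nonneg s) two_ne_zero).1 (by rw [sq_abs, hs])
  rw [norm_mul, norm_div, norm_mul, Complex.norm_I, hs', mul_comm]
  refine mul_le_mul_of_nonneg_right ?_ (norm_nonneg c)
  rw [div_le_iff₀ (by linarith)]
  linarith

/-- The bound on `D - 1` near `c = 0` and the order of vanishing of the sine factor add up to two:
`j` is `2` away from the resonances `1 - d ^ 2 = n ^ 2`, `1` if `n = 0` and `0` if `n = ± 1`. -/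
theorem exists_hillDet_bound (hs : s ^ 2 = 1) (d : ℝ) : ∃ j k : ℕ, j + k = 2 ∧
    (sineFactor =O[𝓝 (1 - (d : ℂ) ^ 2)] fun z => (z - (1 - (d : ℂ) ^ 2)) ^ k) ∧
    ∃ C : ℝ, ∀ᶠ c in 𝓝[{c : ℂ | s * c.im < 0}] 0,
      coeff c 0 = meanValue s c ∧ ‖meanValue s c - 1‖ ≤ 2 * ‖c‖ ∧
      Tendsto (hillDetTrunc c (coeff c 0 - (d : ℂ) ^ 2)) atTop
        (𝓝 (hillDet c (coeff c 0 - (d : ℂ) ^ 2))) ∧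
      ‖hillDet c (coeff c 0 - (d : ℂ) ^ 2) - 1‖ ≤ C * ‖c‖ ^ j := by
  obtain ⟨C, hC, δ, hδ, hsum⟩ := exists_sum_div_norm_le d
  -- the common part of the three cases
  have main : ∀ (j : ℕ) (C' : ℝ),
      (∀ (Λ : ℂ) (K : ℝ), 0 < K → ‖Λ - (1 - (d : ℂ) ^ 2)‖ = K → K ≤ δ → C * K ≤ 1 / 2 →
        ∀ U : Finset ℤ, factorialSum (fun n : ℤ => K / ‖Λ - (n : ℂ) ^ 2‖) 0 U - 1
          - ∑ n ∈ U, K / ‖Λ - (n : ℂ) ^ 2‖ ≤ C' * K ^ j) → 0 ≤ C' →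
      ∃ C : ℝ, ∀ᶠ c in 𝓝[{c : ℂ | s * c.im < 0}] 0,
        coeff c 0 = meanValue s c ∧ ‖meanValue s c - 1‖ ≤ 2 * ‖c‖ ∧
        Tendsto (hillDetTrunc c (coeff c 0 - (d : ℂ) ^ 2)) atTop
          (𝓝 (hillDet c (coeff c 0 - (d : ℂ) ^ 2))) ∧
        ‖hillDet c (coeff c 0 - (d : ℂ) ^ 2) - 1‖ ≤ C * ‖c‖ ^ j := by
    intro j C' hC' hC'0
    refine ⟨C' * 2 ^ j, ?_⟩
    have hsmall : ∀ ε > 0, ∀ᶠ c : ℂ in 𝓝 0, ‖c‖ < ε := fun ε hε => by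
      filter_upwards [Metric.ball_mem_nhds (0 : ℂ) hε] with c hc
      simpa using hc
    filter_upwards [self_mem_nhdsWithin, nhdsWithin_le_nhds eventually_branch,
      nhdsWithin_le_nhds (hsmall (δ / 2) (by positivity)),
      nhdsWithin_le_nhds (hsmall (1 / (4 * C)) (by positivity))] with c hc hb hcδ hcC
    have hK2 := norm_meanValue_sub_one_le hs hb.2
    set K := ‖c * (Complex.I * s / branch c)‖ with hKdef
    have hg : coeff c 0 = meanValue s c := coeff_zero_eq hs hc hb.1
    have hc0 : c ≠ 0 := by rintro rfl; simp at hc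
    have hs0 : (s : ℂ) ≠ 0 := by
      intro h
      have : s = 0 := by exact_mod_cast h
      simp [this] at hs
    have hb0 : branch c ≠ 0 := by
      intro h; have := hb.1; simp [h] at this
    have hKpos : 0 < K := norm_pos_iff.2
      (mul_ne_zero hc0 (div_ne_zero (mul_ne_zero Complex.I_ne_zero hs0) hb0))
    have hΛ : ‖coeff c 0 - (d : ℂ) ^ 2 - (1 - (d : ℂ) ^ 2)‖ = K := by
      rw [hg, meanValue, hKdef, ← norm_neg]
      congr 1
      ring
    have hCK : C * K ≤ 1 / 2 := by
      rw [lt_div_iff₀ (by positivity)] at hcC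
      nlinarith
    obtain ⟨h1, h2⟩ := tendsto_hillDetTrunc_of_bound hKpos.le
      (fun k hk => norm_coeff_le hs hc hb.1 hk) (hC' _ K hKpos hΛ (by linarith) hCK)
    refine ⟨hg, ?_, h1, h2.trans ?_⟩
    · rw [meanValue, sub_sub_cancel_left, norm_neg]
      exact hK2
    · rw [mul_assoc, ← mul_pow]
      gcongr
  have hp : ∀ (Λ : ℂ) (K : ℝ), 0 < K → ∀ n : ℤ, 0 ≤ K / ‖Λ - (n : ℂ) ^ 2‖ := fun Λ K hK n => by
    positivity
  -- At a resonance numerator and denominator coincide, so the weight does not shrink with `c`.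
  have hres : ∀ (Λ : ℂ) (K : ℝ), ‖Λ - (1 - (d : ℂ) ^ 2)‖ = K → ∀ n : ℤ,
      (n : ℂ) ^ 2 = 1 - (d : ℂ) ^ 2 → K / ‖Λ - (n : ℂ) ^ 2‖ ≤ 1 := fun Λ K hK n hn => by
    rw [hn, hK]; exact div_self_le_one K
  by_cases hd0 : d = 0
  · refine ⟨0, 2, rfl, ?_, main 0 26 ?_ (by norm_num)⟩
    · simpa [hd0] using sineFactor_isBigO_one
    · intro Λ K hK hΛ hKδ hCK U
      have h1 := factorialSum_zero_le_of_erase_erase (hp Λ K hK) hCK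
        (r := 1) (s := -1) (by norm_num) (hres Λ K hΛ 1 (by simp [hd0]))
        (hres Λ K hΛ (-1) (by simp [hd0])) U (hsum Λ K hΛ hKδ _ ?_)
      · have h2 : 0 ≤ ∑ n ∈ U, K / ‖Λ - (n : ℂ) ^ 2‖ := Finset.sum_nonneg fun n _ => hp Λ K hK n
        simp only [pow_zero, mul_one]
        linarith
      · intro n hn h
        simp only [Finset.mem_erase] at hn
        have h' : n ^ 2 = 1 := by
          have h'' : (n : ℝ) ^ 2 = 1 := by rw [h, hd0]; norm_num
          exact_mod_cast h''
        rcases sq_eq_sq_iff_eq_or_eq_neg.1 (h'.trans (one_pow 2).symm) with h | h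
        · exact hn.2.1 h
        · exact hn.1 h
  by_cases hd1 : d ^ 2 = 1
  · have hd1' : (d : ℂ) ^ 2 = 1 := by exact_mod_cast hd1
    refine ⟨1, 1, rfl, ?_, main 1 (8 * C) ?_ (by positivity)⟩
    · simpa [hd1'] using sineFactor_isBigO_zero
    · intro Λ K hK hΛ hKδ hCK U
      have h1 := factorialSum_zero_sub_le_of_erase (hp Λ K hK) hCK 0
        (hres Λ K hΛ 0 (by simp [hd1'])) U (hsum Λ K hΛ hKδ _ ?_)
      · rw [pow_one, mul_assoc]
        exact h1
      · intro n hn h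
        rw [hd1, sub_self] at h
        have : (n : ℝ) = 0 := by simpa using h
        exact (Finset.mem_erase.1 hn).1 (by exact_mod_cast this)
  · refine ⟨2, 0, rfl, ?_, main 2 (2 * C ^ 2) ?_ (by positivity)⟩
    · simpa using (hasDerivAt_sineFactor d).continuousAt.tendsto.isBigO_one ℂ
    · intro Λ K hK hΛ hKδ hCK U
      rw [mul_assoc, ← mul_pow]
      refine factorialSum_zero_sub_le (hp Λ K hK) hCK U (hsum Λ K hΛ hKδ _ ?_)
      intro n _ h
      have h' : d ^ 2 = 1 - (n : ℝ) ^ 2 := by linarith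
      have hdpos : 0 < d ^ 2 := by positivity
      have hn1 : (n : ℝ) ^ 2 < 1 := by linarith
      have hn1' : n ^ 2 < 1 := by exact_mod_cast hn1
      have hn0 : n = 0 := by nlinarith [sq_nonneg n, pow_eq_zero_iff (M₀ := ℤ) two_ne_zero (a := n)]
      exact hd1 (by rw [h', hn0]; simp)

/-- `E` is its value with `D` replaced by `1`, differentiable by the chain rule, plus `4 (D - 1)
sin²`, which is `O(c ^ (j + k)) = O(c²)`. -/
theorem hasDerivWithinAt_evans (hs : s ^ 2 = 1) (θ d : ℝ) :
    HasDerivWithinAt (fun c : ℂ => evans c θ d)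
      (-(Complex.I * s) * (2 * Real.pi * sinQuotient d)) {c : ℂ | s * c.im < 0} 0 := by
  obtain ⟨j, k, hjk, hk, C, hC⟩ := exists_hillDet_bound hs d
  have hm0 : meanValue s 0 = 1 := by simp [meanValue]
  have hm := (hasDerivAt_meanValue s).sub_const ((d : ℂ) ^ 2)
  have hmain : HasDerivAt (fun c : ℂ => -2 + 2 * (Real.cos (2 * Real.pi * θ) : ℂ)
      + 4 * sineFactor (meanValue s c - (d : ℂ) ^ 2))
      (-(Complex.I * s) * (2 * Real.pi * sinQuotient d)) 0 := by
    have h := HasDerivAt.comp (h₂ := sineFactor) (0 : ℂ)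
      (by rw [hm0]; exact hasDerivAt_sineFactor d) hm
    refine ((h.const_mul 4).const_add _).congr_deriv ?_
    ring
  have hO1 : (fun c => hillDet c (coeff c 0 - (d : ℂ) ^ 2) - 1)
      =O[𝓝[{c : ℂ | s * c.im < 0}] 0] fun c : ℂ => c ^ j := by
    refine Asymptotics.IsBigO.of_bound C ?_
    filter_upwards [hC] with c hc
    rw [norm_pow]
    exact hc.2.2.2
  have hO2 : (fun c => sineFactor (meanValue s c - (d : ℂ) ^ 2))
      =O[𝓝[{c : ℂ | s * c.im < 0}] 0] fun c : ℂ => c ^ k := by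
    have ht : Tendsto (fun c => meanValue s c - (d : ℂ) ^ 2) (𝓝[{c : ℂ | s * c.im < 0}] 0)
        (𝓝 (1 - (d : ℂ) ^ 2)) := by
      have := hm.continuousAt.tendsto
      rw [hm0] at this
      exact this.mono_left nhdsWithin_le_nhds
    refine (hk.comp_tendsto ht).trans (Asymptotics.IsBigO.of_bound (2 ^ k) ?_)
    filter_upwards [hC] with c hc
    simp only [Function.comp]
    rw [norm_pow, norm_pow, ← mul_pow, sub_sub_sub_cancel_right]
    exact pow_le_pow_left₀ (norm_nonneg _) hc.2.1 k
  have hO : (fun c => 4 * (hillDet c (coeff c 0 - (d : ℂ) ^ 2) - 1)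
      * sineFactor (meanValue s c - (d : ℂ) ^ 2))
      =o[𝓝[{c : ℂ | s * c.im < 0}] 0] fun c : ℂ => c := by
    refine ((hO1.const_mul_left 4).mul hO2).trans_isLittleO ?_
    simp_rw [← pow_add, hjk]
    exact (Asymptotics.isLittleO_pow_id one_lt_two).mono nhdsWithin_le_nhds
  have hrem := hmain.hasDerivWithinAt (s := {c : ℂ | s * c.im < 0})
  rw [hasDerivWithinAt_iff_isLittleO] at hrem ⊢
  have h0 : evans 0 θ d = -2 + 2 * (Real.cos (2 * Real.pi * θ) : ℂ)
      + 4 * sineFactor (meanValue s 0 - (d : ℂ) ^ 2) := by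
    rw [evans_zero_left, hm0]
  simp only [sub_zero] at hrem ⊢
  refine (hrem.add hO).congr' ?_ EventuallyEq.rfl
  filter_upwards [hC] with c hc
  rw [h0, evans, hc.1, ← sineFactor]
  ring

theorem eventually_tendsto_hillDetTrunc (d : ℝ) :
    ∀ᶠ c : ℂ in 𝓝[{c : ℂ | c = 0 ∨ c.im ≠ 0}] 0,
      Tendsto (hillDetTrunc c (coeff c 0 - (d : ℂ) ^ 2)) atTop
        (𝓝 (hillDet c (coeff c 0 - (d : ℂ) ^ 2))) := by
  have hset : {c : ℂ | c = 0 ∨ c.im ≠ 0}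
      = {0} ∪ ({c : ℂ | (1 : ℝ) * c.im < 0} ∪ {c : ℂ | (-1 : ℝ) * c.im < 0}) := by
    ext c
    simp only [Set.mem_ofPred_eq, Set.mem_union, Set.mem_singleton_iff, one_mul, neg_mul, neg_lt_zero]
    rw [← ne_iff_lt_or_gt]
  rw [hset, nhdsWithin_union, nhdsWithin_union, eventually_sup, eventually_sup]
  refine ⟨?_, ?_, ?_⟩
  · rw [nhdsWithin_singleton, eventually_pure, hillDet_zero_left]
    exact tendsto_hillDetTrunc_zero_left _
  · obtain ⟨_, _, _, _, _, h⟩ := exists_hillDet_bound (s := 1) (by norm_num) d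
    exact h.mono fun c hc => hc.2.2.1
  · obtain ⟨_, _, _, _, _, h⟩ := exists_hillDet_bound (s := -1) (by norm_num) d
    exact h.mono fun c hc => hc.2.2.1

end Determinant

/-! ### The Evans function at `c = 0` and its normal derivative on the circles. -/

section Unperturbed

theorem hasDerivAt_evans_zero {x y : ℝ → ℝ} {x' y' t : ℝ} (hx : HasDerivAt x x' t)
    (hy : HasDerivAt y y' t) :
    HasDerivAt (fun r => evans 0 (x r) (y r))
      (-4 * Real.pi * Complex.sin (2 * Real.pi * x t) * x'
        - 2 * y t * y' * (2 * Real.pi * sinQuotient (y t))) t := by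
  simp_rw [evans_zero_left]
  have h1 : HasDerivAt (fun r => ((Real.cos (2 * Real.pi * x r) : ℝ) : ℂ)) _ t :=
    ((hx.const_mul (2 * Real.pi)).cos).ofReal_comp
  have h2 : HasDerivAt (fun r => 1 - ((y r : ℝ) : ℂ) ^ 2) _ t :=
    (hy.ofReal_comp.pow 2).const_sub 1
  have h3 := HasDerivAt.comp t (hasDerivAt_sineFactor (y t)) h2
  refine (((h1.const_mul 2).const_add (-2)).add (h3.const_mul 4)).congr_deriv ?_
  push_cast
  simp
  ring

theorem sinQuotient_eq_ofReal {t d : ℝ} (h : t ^ 2 + d ^ 2 = 1) :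
    sinQuotient d = ((if t = 0 then 2 * Real.pi else Real.sin (2 * Real.pi * t) / t : ℝ) : ℂ) := by
  split_ifs with ht
  · rw [sinQuotient, if_pos (by rw [ht] at h; linarith)]
    push_cast
    rfl
  · rw [sinQuotient_of_sq_eq (y := t) (by rw [eq_sub_iff_add_eq]; exact_mod_cast h)
      (by exact_mod_cast ht)]
    push_cast
    rfl

theorem sin_div_self_pos {t : ℝ} (ht : t ≠ 0) (h : |t| < 1 / 2) :
    0 < Real.sin (2 * Real.pi * t) / t := by
  have h' := abs_lt.1 h
  have hpi := Real.pi_pos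
  rcases lt_or_gt_of_ne ht with h0 | h0
  · exact div_pos_of_neg_of_neg (Real.sin_neg_of_neg_of_neg_pi_lt (by nlinarith) (by nlinarith)) h0
  · exact div_pos (Real.sin_pos_of_pos_of_lt_pi (by positivity) (by nlinarith)) h0

theorem sin_div_self_neg {t : ℝ} (h : 1 / 2 < |t|) (h1 : |t| < 1) :
    Real.sin (2 * Real.pi * t) / t < 0 := by
  have hpi := Real.pi_pos
  have key : ∀ u : ℝ, 1 / 2 < u → u < 1 → Real.sin (2 * Real.pi * u) < 0 := by
    intro u hu hu1
    rw [← Real.sin_sub_two_pi]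
    exact Real.sin_neg_of_neg_of_neg_pi_lt (by nlinarith) (by nlinarith)
  rcases abs_cases t with ⟨ha, h0⟩ | ⟨ha, h0⟩ <;> rw [ha] at h h1
  · exact div_neg_of_neg_of_pos (key t h h1) (by linarith)
  · have := key (-t) h h1
    rw [mul_neg, Real.sin_neg] at this
    exact div_neg_of_pos_of_neg (by linarith) h0

theorem exists_hasLineDerivAt_evans (l : ℤ) (θ d : ℝ) (h : (θ - l) ^ 2 + d ^ 2 = 1) :
    ∃ v : ℝ, (v : ℂ) = -4 * Real.pi * sinQuotient d ∧
      HasLineDerivAt ℝ (fun p : ℝ × ℝ => evans 0 p.1 p.2) (v : ℂ) (θ, d) (θ - l, d) ∧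
      (0 < |d| → |d| < Real.sqrt 3 / 2 → 0 < v) ∧ (Real.sqrt 3 / 2 < |d| → v < 0) := by
  set t := θ - l with ht
  have hpi := Real.pi_pos
  have hS := sinQuotient_eq_ofReal h
  set S : ℝ := if t = 0 then 2 * Real.pi else Real.sin (2 * Real.pi * t) / t with hSdef
  have hsin : Real.sin (2 * Real.pi * θ) * t = t ^ 2 * S := by
    have : Real.sin (2 * Real.pi * θ) = Real.sin (2 * Real.pi * t) := by
      rw [ht, mul_sub, mul_comm (2 * Real.pi) (l : ℝ), Real.sin_sub_int_mul_two_pi]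
    rw [this, hSdef]
    split_ifs with h0
    · simp [h0]
    · field_simp
  have h3 : (Real.sqrt 3 / 2) ^ 2 = 3 / 4 := by
    rw [div_pow, Real.sq_sqrt (by norm_num)]; norm_num
  have h3' : 0 ≤ Real.sqrt 3 / 2 := by positivity
  refine ⟨-4 * Real.pi * S, ?_, ?_, ?_, ?_⟩
  · rw [hS]; push_cast; ring
  · unfold HasLineDerivAt
    have hx : HasDerivAt (fun r : ℝ => θ + r * t) t 0 := by
      simpa using ((hasDerivAt_id (0 : ℝ)).mul_const t).const_add θ
    have hy : HasDerivAt (fun r : ℝ => d + r * d) d 0 := by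
      simpa using ((hasDerivAt_id (0 : ℝ)).mul_const d).const_add d
    refine (hasDerivAt_evans_zero hx hy).congr_deriv ?_
    simp only [zero_mul, add_zero]
    rw [hS]
    -- Both parts are multiples of `S`, with factors `t²` and `d²` adding up to `1`.
    have hval : -4 * Real.pi * Real.sin (2 * Real.pi * θ) * t - 2 * d * d * (2 * Real.pi * S)
        = -4 * Real.pi * S := by
      linear_combination (-4 * Real.pi) * hsin - 4 * Real.pi * S * h
    rw [← hval]
    push_cast
    ring
  · intro hd0 hd
    have hd2 : |d| ^ 2 < 3 / 4 := h3 ▸ pow_lt_pow_left₀ hd (abs_nonneg d) two_ne_zero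
    have hd2' : 0 < |d| ^ 2 := by positivity
    rw [sq_abs] at hd2 hd2'
    -- On the circle `|d| < √3 / 2` means `|t| > 1 / 2`, where `sin (2πt) / t` changes sign.
    have ht1 : 1 / 2 < |t| := lt_of_pow_lt_pow_left₀ 2 (abs_nonneg t) (by rw [sq_abs]; linarith)
    have ht2 : |t| < 1 := lt_of_pow_lt_pow_left₀ 2 zero_le_one (by rw [sq_abs]; linarith)
    have hneg := sin_div_self_neg ht1 ht2
    have ht0 : t ≠ 0 := by rintro h0; rw [h0] at ht1; norm_num at ht1
    rw [hSdef, if_neg ht0]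
    nlinarith
  · intro hd
    have hd2 : 3 / 4 < |d| ^ 2 := h3 ▸ pow_lt_pow_left₀ hd h3' two_ne_zero
    rw [sq_abs] at hd2
    have ht1 : |t| < 1 / 2 := lt_of_pow_lt_pow_left₀ 2 (by norm_num) (by rw [sq_abs]; linarith)
    have hSpos : 0 < S := by
      rw [hSdef]
      split_ifs with h0
      · positivity
      · exact sin_div_self_pos h0 ht1
    nlinarith [mul_pos hpi hSpos]

end Unperturbed

end HillEvans

theorem mainTheorem8 :
    -- near `c = 0`, off the branch cut, Hill's determinant exists as a limit
    (∀ d : ℝ, ∀ᶠ c : ℂ in 𝓝[{c : ℂ | c = 0 ∨ c.im ≠ 0}] 0,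
      Tendsto (HillEvans.hillDetTrunc c (HillEvans.coeff c 0 - (d : ℂ) ^ 2)) atTop
        (𝓝 (HillEvans.hillDet c (HillEvans.coeff c 0 - (d : ℂ) ^ 2)))) ∧
    -- derivatives at `c = 0`: from below (upper sign) and above (lower sign) the cut, and in `d`
    (∀ θ d : ℝ, ∃ Ebelow Eabove Ed : ℂ,
      HasDerivWithinAt (fun c : ℂ => HillEvans.evans c θ d) Ebelow {c : ℂ | c.im < 0} 0 ∧
      HasDerivWithinAt (fun c : ℂ => HillEvans.evans c θ d) Eabove {c : ℂ | 0 < c.im} 0 ∧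
      HasDerivAt (fun x : ℝ => HillEvans.evans 0 θ x) Ed d ∧
      Complex.I * Ebelow = 2 * Real.pi * HillEvans.sinQuotient d ∧
      -Complex.I * Eabove = 2 * Real.pi * HillEvans.sinQuotient d ∧
      Ed = -2 * d * (2 * Real.pi * HillEvans.sinQuotient d)) ∧
    -- derivative of `E(0; θ, d)` along the outward unit normal of the circle with centre `(l, 0)`
    (∀ (l : ℤ) (θ d : ℝ), (θ - l) ^ 2 + d ^ 2 = 1 →
      ∃ v : ℝ, (v : ℂ) = -4 * Real.pi * HillEvans.sinQuotient d ∧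
        HasLineDerivAt ℝ (fun p : ℝ × ℝ => HillEvans.evans 0 p.1 p.2) (v : ℂ) (θ, d) (θ - l, d) ∧
        (0 < |d| → |d| < Real.sqrt 3 / 2 → 0 < v) ∧
        (Real.sqrt 3 / 2 < |d| → v < 0)) := by
  refine ⟨HillEvans.eventually_tendsto_hillDetTrunc, fun θ d => ?_,
    HillEvans.exists_hasLineDerivAt_evans⟩
  have hbelow := HillEvans.hasDerivWithinAt_evans (s := 1) (by norm_num) θ d
  have habove := HillEvans.hasDerivWithinAt_evans (s := -1) (by norm_num) θ d
  have hd := HillEvans.hasDerivAt_evans_zero (hasDerivAt_const d θ) (hasDerivAt_id d)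
  simp only [one_mul, neg_mul, neg_lt_zero] at hbelow habove
  refine ⟨_, _, _, hbelow, habove, hd, ?_, ?_, ?_⟩
  · push_cast
    linear_combination (-2 * Real.pi * HillEvans.sinQuotient d) * Complex.I_sq
  · push_cast
    linear_combination (-2 * Real.pi * HillEvans.sinQuotient d) * Complex.I_sq
  · simp only [id]
    push_cast
    ring
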